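/- Let $r\ge 2$ and $k\ge 3$ be integers and let $n_r\ge n_{r-1}\ge\cdots\ge n_1\ge 2k-1$. Let $\mathcal{K}_{n_1,\ldots,n_r}$ be the complete $r$-partite $r$-uniform hypergraph on disjoint vertex classes $V_1,\ldots,V_r$ with $|V_i|=n_i$; its edges are the $r$-sets having exactly one vertex in each class. A $k$-matching is a set of $k$ pairwise disjoint edges; it is rainbow in an edge-colouring if its edges have pairwise different colours. Then the maximum number of colours used by an edge-colouring of $\mathcal{K}_{n_1,\ldots,n_r}$ with no rainbow $k$-matching is $$ar_r(\mathcal{K}_{n_1,\ldots,n_r},M_k)=(k-2)\,n_2\cdots n_r+1.$$ Moreover, the extremal colouring is unique up to isomorphism: an edge-colouring of $\mathcal{K}_{n_1,\ldots,n_r}$ uses exactly $(k-2)n_2\cdots n_r+1$ colours and has no rainbow $k$-matching if and only if it is a colouring $\phi_r$, that is, there are a class $V_j$ with $|V_j|=n_1$ and a set $S\subseteq V_j$ with $|S|=k-2$ such that all edges meeting $S$ have pairwise distinct colours and all the other edges share one further colour. -/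

import Mathlib

/-- Vertices of the complete multipartite hypergraph with classes of sizes `n i`. -/
abbrev PartVertex {r : ℕ} (n : Fin r → ℕ) : Type := Σ i : Fin r, Fin (n i)

/-- The `i`-th vertex class. -/
def vertexClass {r : ℕ} (n : Fin r → ℕ) (i : Fin r) : Set (PartVertex n) :=
  {v | v.1 = i}

/-- The complete `r`-partite `r`-uniform hypergraph with vertex classes of sizes `n i`: its edges
are the `r`-element vertex sets which meet every class in exactly one vertex. -/
def completeMultipartiteHypergraph {r : ℕ} (n : Fin r → ℕ) : Hypergraph (PartVertex n) where
  vertexSet := Set.univ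
  edgeSet := {e | e.encard = r ∧ ∀ i : Fin r, (e ∩ vertexClass n i).encard = 1}
  subset_vertexSet_of_mem_edgeSet' := fun e _ => Set.subset_univ e

/-- A colouring of the edges of `H`. -/
abbrev EdgeColoring {V : Type*} (H : Hypergraph V) : Type _ := H.edgeSet → ℕ

/-- The colouring `c` uses exactly `m` colours. -/
def UsesExactly {V : Type*} {H : Hypergraph V} (c : EdgeColoring H) (m : ℕ) : Prop :=
  (Set.range c).encard = m

/-- `M` is a matching of `H`: no two of its edges have a common vertex. -/
def IsHyperMatching {V : Type*} {H : Hypergraph V} (M : Finset H.edgeSet) : Prop :=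
  ∀ e ∈ M, ∀ f ∈ M, e ≠ f → Disjoint (e : Set V) (f : Set V)

/-- There is a matching with `k` edges whose edges have pairwise different colours. -/
def HasRainbowMatching {V : Type*} {H : Hypergraph V} (c : EdgeColoring H) (k : ℕ) : Prop :=
  ∃ M : Finset H.edgeSet, M.card = k ∧ IsHyperMatching M ∧ Set.InjOn c (M : Set H.edgeSet)

/-- `m` is the anti-Ramsey number of the `k`-matching in `H`: the maximum number of colours in an
edge-colouring of `H` without a rainbow `k`-matching. -/
def IsAntiRamseyNumber {V : Type*} (H : Hypergraph V) (k m : ℕ) : Prop :=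
  IsGreatest {m : ℕ | ∃ c : EdgeColoring H, UsesExactly c m ∧ ¬ HasRainbowMatching c k} m

/-- `c` is the colouring `φ_r` (up to renaming colours and permuting classes of equal size):
for some set `S` of `k - 2` vertices of a smallest class, the edges meeting `S` have pairwise
distinct colours, and all the other edges have one further colour. -/
def IsPhiColoring {r : ℕ} (n : Fin r → ℕ) (k : ℕ)
    (c : EdgeColoring (completeMultipartiteHypergraph n)) : Prop :=
  ∃ i : Fin r, (∀ j, n i ≤ n j) ∧
    ∃ S : Finset (PartVertex n), (S : Set (PartVertex n)) ⊆ vertexClass n i ∧ S.card = k - 2 ∧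
      Set.InjOn c {e | ((e : Set (PartVertex n)) ∩ S).Nonempty} ∧
      ∃ a : ℕ, ∀ e : (completeMultipartiteHypergraph n).edgeSet,
        c e = a ↔ ¬ ((e : Set (PartVertex n)) ∩ S).Nonempty

/-!
Edges are encoded as transversals `f : ∀ i, Fin (n i)`, perfect matchings as families
`σ : Fin (n 0) → ∀ i, Fin (n i)` which are injective in every coordinate, and `N` denotes
`∏ i, n i.succ`. A colouring without a rainbow `k`-matching has at most `k - 1` colours on every
perfect matching, and each edge lies in the same share `1 / N` of the translates of a perfect
matching.

The heart of the matter is that a colouring with more than `(k - 2) * N` colours and no rainbow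
`k`-matching has a colour `a` that occurs in every perfect matching. Granted this,
`isStarColoring_of_common_color` finishes: take a system `B` of representatives of the colours
other than `a`. Every perfect matching has at most `k - 2` edges in `B`, so by averaging
`#B ≤ (k - 2) * N`, and equality forces exactly `k - 2` edges of `B` in every perfect matching.
Interchanging one coordinate between two edges of a perfect matching then shows that membership in
`B` depends on a single coordinate (`exists_coord_of_card_const`), so `B` consists of the edges
meeting a set of `k - 2` vertices of a smallest class. As this holds for each choice of
representatives, all the other edges have colour `a`.

The common colour is found by induction on the number of classes.

* For two classes (`exists_common_color_two`), averaging gives a perfect matching `p` with `k - 1`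
  colours. Interchanging two of its edges, or moving one of them to a free vertex, brings in no more
  new colours than it destroys colours of `p`. Summing over all exchanges bounds the total number of
  colours in terms of the number of colours occurring once and twice on `p`; only if `k - 2` colours
  occur once and a single colour `a` fills the rest of `p` is the bound large enough
  (`ArrayRainbowFree.exists_unique_structure`). Applied to the matchings one exchange away from `p`,
  the same statement shows that all edges avoiding the `k - 2` exceptional edges have colour `a`.
* For more classes, merge the last class with the first along an injection. By averaging, one of the
  merged hypergraphs has more than its share of colours, so by induction it has a star colouring with
  centre `S` and common colour `a`. An edge `g` of the whole hypergraph that avoids the vertices of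
  `S` has colour `a`, since otherwise `g`, some `k - 2` edges of the star and an edge of colour `a`
  form a rainbow matching (`eq_common_color_of_notMem`).

In both cases the edges known to have colour `a` are those avoiding at most `2 * (k - 2)` vertices,
and a perfect matching has `n 0 ≥ 2 * k - 1` edges, so it contains one of them.
-/

open Finset Function

/-! ### Transversals, rainbow matchings and averaging -/

/-- A family of transversals is a matching if it is injective in every coordinate. -/
def CoordInjective {ι X : Type*} {n : ι → ℕ} (σ : X → ∀ i, Fin (n i)) : Prop :=
  ∀ i, Injective fun x => σ x i

/-- No `k` pairwise disjoint transversals have pairwise different colours. -/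
def RainbowFree {ι : Type*} {n : ι → ℕ} (c : (∀ i, Fin (n i)) → ℕ) (k : ℕ) : Prop :=
  ∀ e : Fin k → ∀ i, Fin (n i), CoordInjective e → ¬ Injective (c ∘ e)

/-- Every finite set of values of `f` has a system of representatives. -/
theorem exists_injOn_image_eq {X Y : Type*} [Fintype X] [DecidableEq Y] (f : X → Y) {t : Finset Y}
    (ht : t ⊆ univ.image f) : ∃ u : Finset X, Set.InjOn f u ∧ u.image f = t := by
  obtain ⟨u, -, hu⟩ := exists_subset_injOn_image_eq_of_surjOn (f := f) Set.univ t
    (fun y hy => by simpa using ht hy)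
  exact ⟨u, hu⟩

section General

variable {ι : Type*} {n : ι → ℕ} {c : (∀ i, Fin (n i)) → ℕ} {k : ℕ}

theorem RainbowFree.card_lt (hc : RainbowFree c k) {X : Type*} {σ : X → ∀ i, Fin (n i)}
    (hσ : CoordInjective σ) (A : Finset X) (hA : Set.InjOn (c ∘ σ) A) : #A < k := by
  by_contra! h
  have hcard : Fintype.card (Fin k) ≤ Fintype.card A := by simpa using h
  obtain ⟨g⟩ := Function.Embedding.nonempty_of_card_le hcard
  refine hc (fun s => σ (g s)) (fun i s s' h => g.injective (Subtype.ext (hσ i h))) ?_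
  intro s s' h
  exact g.injective (Subtype.ext (hA (g s).2 (g s').2 h))

theorem RainbowFree.card_image_lt (hc : RainbowFree c k) {X : Type*} [Fintype X]
    {σ : X → ∀ i, Fin (n i)} (hσ : CoordInjective σ) : #(univ.image (c ∘ σ)) < k := by
  obtain ⟨A, hinj, hA⟩ := exists_injOn_image_eq (c ∘ σ) Subset.rfl
  rw [← hA, Finset.card_image_of_injOn hinj]
  exact hc.card_lt hσ A hinj

theorem RainbowFree.not_injective (hc : RainbowFree c k) {X : Type*} [Fintype X]
    {σ : X → ∀ i, Fin (n i)} (hσ : CoordInjective σ) (hX : k ≤ Fintype.card X) :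
    ¬ Injective (c ∘ σ) := fun h =>
  absurd (hc.card_lt hσ univ h.injOn) (by simpa using hX)

variable [Fintype ι] [DecidableEq ι]

/-- Every transversal lies in equally many translates of a family `σ`, so the average of
`#{x | σ' x ∈ B}` over the translates `σ'` of `σ` is `|X| |B| / ∏ n i`. -/
theorem sum_card_translates [∀ i, NeZero (n i)] {X : Type*} [Fintype X]
    (σ : X → ∀ i, Fin (n i)) (B : Finset (∀ i, Fin (n i))) :
    ∑ τ : ∀ i, Fin (n i), #{x | σ x + τ ∈ B} = Fintype.card X * #B := by
  simp only [Finset.card_filter]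
  rw [Finset.sum_comm]
  have : ∀ x, ∑ τ : ∀ i, Fin (n i), (if σ x + τ ∈ B then 1 else 0) = #B := by
    intro x
    exact (Equiv.sum_comp (Equiv.addLeft (σ x)) (fun f => if f ∈ B then 1 else 0)).trans (by simp)
  simp [this]

theorem card_mul_card_le [∀ i, NeZero (n i)] {X : Type*} [Fintype X]
    {σ : X → ∀ i, Fin (n i)} (hσ : CoordInjective σ) {B : Finset (∀ i, Fin (n i))} {t : ℕ}
    (ht : ∀ σ : X → ∀ i, Fin (n i), CoordInjective σ → #{x | σ x ∈ B} ≤ t) :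
    Fintype.card X * #B ≤ t * ∏ i, n i := by
  rw [← sum_card_translates σ B]
  refine (Finset.sum_le_card_nsmul univ _ t fun τ _ => ht (fun x => σ x + τ) ?_).trans ?_
  · intro i x y h
    exact hσ i (add_right_cancel (b := τ i) h)
  · simp [mul_comm]

theorem card_eq_of_le_card_mul_card [∀ i, NeZero (n i)] {X : Type*} [Fintype X]
    {σ : X → ∀ i, Fin (n i)} (hσ : CoordInjective σ) {B : Finset (∀ i, Fin (n i))} {t : ℕ}
    (ht : ∀ σ : X → ∀ i, Fin (n i), CoordInjective σ → #{x | σ x ∈ B} ≤ t)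
    (hB : t * ∏ i, n i ≤ Fintype.card X * #B) : #{x | σ x ∈ B} = t := by
  have hle : ∀ τ ∈ (univ : Finset (∀ i, Fin (n i))), #{x | σ x + τ ∈ B} ≤ t := fun τ _ =>
    ht (fun x => σ x + τ) fun i x y h => hσ i (add_right_cancel (b := τ i) h)
  have hsum : ∑ τ : ∀ i, Fin (n i), #{x | σ x + τ ∈ B} = ∑ τ : ∀ i, Fin (n i), t := by
    refine le_antisymm (Finset.sum_le_sum hle) ?_
    rw [sum_card_translates σ B]
    simpa [mul_comm] using hB
  simpa using (Finset.sum_eq_sum_iff_of_le hle).1 hsum 0 (mem_univ _)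

end General

/-! ### Sets meeting all perfect matchings equally -/

section Exchange

/-- An injection `Fin m → Fin n` can be prescribed at two points. -/
theorem exists_injective_apply_eq_apply_eq {m n : ℕ} (hmn : m ≤ n) {x x' : Fin m} (hx : x ≠ x')
    {y y' : Fin n} (hy : y ≠ y') : ∃ s : Fin m → Fin n, Injective s ∧ s x = y ∧ s x' = y' := by
  set a := Fin.castLE hmn x with ha
  set a' := Fin.castLE hmn x' with ha'
  have haa : a ≠ a' := fun h => hx (Fin.castLE_injective hmn h)
  refine ⟨fun z => Equiv.swap (Equiv.swap a y a') y' (Equiv.swap a y (Fin.castLE hmn z)), ?_, ?_, ?_⟩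
  · exact (Equiv.injective _).comp ((Equiv.injective _).comp (Fin.castLE_injective hmn))
  · simp only [← ha, Equiv.swap_apply_left]
    refine Equiv.swap_apply_of_ne_of_ne ?_ hy
    intro h
    have := congrArg (Equiv.swap a y) h
    rw [Equiv.swap_apply_right, Equiv.swap_apply_self] at this
    exact haa this
  · simp only [← ha', Equiv.swap_apply_left]

variable {r : ℕ} {n : Fin (r + 2) → ℕ}

theorem exists_coordInjective (hmin : ∀ i, n 0 ≤ n i) :
    ∃ σ : Fin (n 0) → ∀ i, Fin (n i), CoordInjective σ :=
  ⟨fun x i => Fin.castLE (hmin i) x, fun i => Fin.castLE_injective (hmin i)⟩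

/-- Two disjoint transversals lie in a common perfect matching. -/
theorem exists_coordInjective_of_ne (hmin : ∀ i, n 0 ≤ n i) {x x' : Fin (n 0)} (hx : x ≠ x')
    {e f : ∀ i, Fin (n i)} (hef : ∀ i, e i ≠ f i) :
    ∃ σ : Fin (n 0) → ∀ i, Fin (n i), CoordInjective σ ∧ σ x = e ∧ σ x' = f := by
  choose s hs hx hx' using fun i => exists_injective_apply_eq_apply_eq (hmin i) hx (hef i)
  exact ⟨fun x i => s i x, hs, funext hx, funext hx'⟩

/-- Interchanging the `i`-th coordinates of two edges of a perfect matching gives a perfect matching,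
so it preserves the number of members of `B` among the two edges. -/
theorem exchange_of_card_const (hmin : ∀ i, n 0 ≤ n i) (h2 : 2 ≤ n 0)
    {B : Finset (∀ i, Fin (n i))} {t : ℕ}
    (ht : ∀ σ : Fin (n 0) → ∀ i, Fin (n i), CoordInjective σ → #{x | σ x ∈ B} = t)
    {e f : ∀ i, Fin (n i)} (hef : ∀ i, e i ≠ f i) (i : Fin (r + 2)) :
    (if e ∈ B then 1 else 0) + (if f ∈ B then 1 else 0) =
      (if update e i (f i) ∈ B then 1 else 0) + (if update f i (e i) ∈ B then 1 else 0) := by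
  set x : Fin (n 0) := ⟨0, by omega⟩
  set x' : Fin (n 0) := ⟨1, by omega⟩
  have hx : x ≠ x' := by simp [x, x']
  obtain ⟨σ, hσ, rfl, rfl⟩ := exists_coordInjective_of_ne hmin hx hef
  have h1 := ht σ hσ
  have h2 := ht (fun z => update (σ z) i (σ (Equiv.swap x x' z) i)) (by
    intro j
    by_cases hj : j = i
    · subst hj
      simp only [update_self]
      exact (hσ j).comp (Equiv.injective (Equiv.swap x x'))
    · simpa [hj] using hσ j)
  rw [Finset.card_filter, ← Finset.add_sum_erase _ _ (mem_univ x),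
    ← Finset.add_sum_erase _ _ (show x' ∈ univ.erase x by simp [hx.symm])] at h1 h2
  have h3 : ∑ z ∈ (univ.erase x).erase x',
      (if update (σ z) i (σ (Equiv.swap x x' z) i) ∈ B then 1 else 0) =
      ∑ z ∈ (univ.erase x).erase x', (if σ z ∈ B then 1 else 0) := by
    refine Finset.sum_congr rfl fun z hz => ?_
    simp only [mem_erase, mem_univ, and_true] at hz
    rw [Equiv.swap_apply_of_ne_of_ne hz.2 hz.1, update_eq_self]
  rw [h3] at h2
  simp only [Equiv.swap_apply_left, Equiv.swap_apply_right] at h2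
  omega

/-- A function of several variables which is not constant changes its value under a change of
some single variable. -/
theorem exists_update_of_not_const {ι : Type*} [Fintype ι] [DecidableEq ι] {V : ι → Type*}
    {b : (∀ i, V i) → Prop} {e f : ∀ i, V i} (he : b e) (hf : ¬ b f) :
    ∃ (e : ∀ i, V i) (j : ι) (y : V j), b e ∧ ¬ b (update e j y) := by
  by_contra! H
  refine hf ?_
  have : ∀ s : Finset ι, b (s.piecewise f e) := by
    intro s
    induction s using Finset.induction_on with
    | empty => simpa using he
    | insert j s _ ih => rw [Finset.piecewise_insert]; exact H _ _ _ ih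
  simpa using this univ

theorem exists_avoid {m : ℕ} (hm : 3 ≤ m) (y y' : Fin m) : ∃ z, z ≠ y ∧ z ≠ y' := by
  have : #({y, y'} : Finset (Fin m)) < #(univ : Finset (Fin m)) :=
    (Finset.card_le_two).trans_lt (by simpa using (show 2 < m from hm))
  obtain ⟨z, -, hz⟩ := Finset.exists_mem_notMem_of_card_lt_card this
  exact ⟨z, by simpa [not_or] using hz⟩

/-- If every perfect matching has the same number of members in `B`, then whether a transversal
belongs to `B` depends on one coordinate only. -/
theorem exists_coord_of_card_const (hmin : ∀ i, n 0 ≤ n i) (h3 : 3 ≤ n 0)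
    {B : Finset (∀ i, Fin (n i))} {t : ℕ}
    (ht : ∀ σ : Fin (n 0) → ∀ i, Fin (n i), CoordInjective σ → #{x | σ x ∈ B} = t)
    (ht0 : 0 < t) (htn : t < n 0) :
    ∃ (j : Fin (r + 2)) (S : Finset (Fin (n j))), ∀ f, f ∈ B ↔ f j ∈ S := by
  obtain ⟨σ, hσ⟩ := exists_coordInjective hmin
  have hσt := ht σ hσ
  obtain ⟨x, hx⟩ : ∃ x, σ x ∈ B := by
    by_contra! H
    simp [H] at hσt
    omega
  obtain ⟨x', hx'⟩ : ∃ x, σ x ∉ B := by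
    by_contra! H
    simp [H] at hσt
    omega
  obtain ⟨e, j, y, he, hey⟩ := exists_update_of_not_const (b := (· ∈ B)) hx hx'
  have hyj : y ≠ e j := by
    rintro rfl
    simp [he] at hey
  -- the change at `j` has the same effect on every transversal disjoint from the given one
  have key : ∀ e f : ∀ i, Fin (n i), e j ≠ y → e ∈ B → update e j y ∉ B →
      (∀ i, i ≠ j → f i ≠ e i) → update f j (e j) ∈ B ∧ update f j y ∉ B := by
    intro e f hej he hey hf
    have := exchange_of_card_const hmin (by omega) ht (e := e) (f := update f j y) (by
      intro i
      by_cases hi : i = j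
      · subst hi; simpa using hej
      · simpa [hi] using (hf i hi).symm) j
    simp only [update_self, update_idem, he, hey, if_true, if_false] at this
    split_ifs at this with h1 h2 <;> simp_all
  have key' : ∀ f : ∀ i, Fin (n i), update f j (e j) ∈ B ∧ update f j y ∉ B := by
    intro f
    choose g hg hg' using fun i => exists_avoid (h3.trans (hmin i)) (e i) (f i)
    have h1 := key e (update g j (e j)) hyj.symm he hey (fun i hi => by simpa [hi] using hg i)
    simp only [update_idem] at h1
    have := key (update g j (e j)) f (by simpa using hyj.symm) h1.1 (by simpa using h1.2)
      (fun i hi => by simpa [hi] using (hg' i).symm)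
    simpa using this
  have indep : ∀ f g : ∀ i, Fin (n i), f j = g j → f ∈ B → g ∈ B := by
    intro f g hfg hf
    by_contra hg
    by_cases hfe : f j = y
    · have := (key' f).2
      rw [← hfe, update_eq_self] at this
      exact this hf
    have key2 : ∀ g : ∀ i, Fin (n i), update g j (f j) ∈ B := by
      intro g
      choose h hh hh' using fun i => exists_avoid (h3.trans (hmin i)) (f i) (g i)
      have h1 := key f (update h j (f j)) hfe hf (key' f).2 (fun i hi => by simpa [hi] using hh i)
      simp only [update_idem] at h1
      have := key (update h j (f j)) g (by simpa using hfe) h1.1 (by simpa using h1.2)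
        (fun i hi => by simpa [hi] using (hh' i).symm)
      simpa using this.1
    have := key2 g
    rw [hfg, update_eq_self] at this
    exact hg this
  refine ⟨j, B.image fun f => f j, fun f => ⟨fun hf => mem_image_of_mem _ hf, fun hf => ?_⟩⟩
  obtain ⟨g, hg, hgf⟩ := mem_image.1 hf
  exact indep g f hgf hg

end Exchange

/-! ### Star colourings -/

section Star

variable {r : ℕ} {n : Fin (r + 2) → ℕ} {k : ℕ} {c : (∀ i, Fin (n i)) → ℕ}

/-- For some set `S` of `k - 2` vertices of a class of smallest size, the transversals meeting `S`
have colours of their own and all the others have one colour. -/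
def IsStarColoring (c : (∀ i, Fin (n i)) → ℕ) (k : ℕ) : Prop :=
  ∃ (j : Fin (r + 2)) (a : ℕ) (S : Finset (Fin (n j))), n j = n 0 ∧ #S = k - 2 ∧
    (∀ f, f j ∉ S → c f = a) ∧ ∀ f g, f j ∈ S → c f = c g → f = g

theorem card_filter_coord_mem_le {X : Type*} [Fintype X] {σ : X → ∀ i, Fin (n i)}
    (hσ : CoordInjective σ) (i : Fin (r + 2)) (S : Finset (Fin (n i))) : #{x | σ x i ∈ S} ≤ #S :=
  Finset.card_le_card_of_injOn (fun x => σ x i) (fun x hx => by simpa using hx) (hσ i).injOn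

/-- A perfect matching has an edge avoiding a small set of vertices in two classes. -/
theorem exists_coord_notMem {σ : Fin (n 0) → ∀ i, Fin (n i)} (hσ : CoordInjective σ)
    (i j : Fin (r + 2)) (S : Finset (Fin (n i))) (T : Finset (Fin (n j))) (h : #S + #T < n 0) :
    ∃ x, σ x i ∉ S ∧ σ x j ∉ T := by
  have h1 : #(({x | σ x i ∈ S} : Finset (Fin (n 0))) ∪ ({x | σ x j ∈ T} : Finset (Fin (n 0)))) <
      #(univ : Finset (Fin (n 0))) := by
    have h2 := card_filter_coord_mem_le hσ i S
    have h3 := card_filter_coord_mem_le hσ j T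
    have h4 := Finset.card_union_le ({x | σ x i ∈ S} : Finset (Fin (n 0))) {x | σ x j ∈ T}
    simp only [card_univ, Fintype.card_fin]
    omega
  obtain ⟨x, -, hx⟩ := Finset.exists_mem_notMem_of_card_lt_card h1
  exact ⟨x, by simpa [not_or] using hx⟩

/-- If each perfect matching has exactly `t` edges meeting `S`, then `S` has `t` vertices. -/
theorem card_eq_of_card_coord_mem_const (hmin : ∀ i, n 0 ≤ n i) {j : Fin (r + 2)}
    {S : Finset (Fin (n j))} {t : ℕ} (htn : t < n 0)
    (ht : ∀ σ : Fin (n 0) → ∀ i, Fin (n i), CoordInjective σ → #{x | σ x j ∈ S} = t) :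
    #S = t := by
  -- perfect matchings use every set of `n 0` vertices of the class `j`
  have key : ∀ U : Finset (Fin (n j)), #U = n 0 → #(U ∩ S) = t := by
    intro U hU
    have hj : Injective (fun x => U.orderEmbOfFin hU x) := (U.orderEmbOfFin hU).injective
    obtain ⟨σ, hσ⟩ := exists_coordInjective hmin
    have hcoord : CoordInjective (fun x => update (σ x) j (U.orderEmbOfFin hU x)) := by
      intro i
      by_cases hi : i = j
      · subst hi; simpa using! hj
      · simpa [hi] using hσ i
    have h1 := ht _ hcoord
    rw [← h1]
    simp only [update_self]
    rw [← Finset.card_image_of_injective _ hj]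
    congr 1
    ext y
    simp only [mem_inter, mem_image, mem_filter, mem_univ, true_and]
    constructor
    · rintro ⟨hy, hyS⟩
      have : y ∈ Set.range (U.orderEmbOfFin hU) := by simpa using hy
      obtain ⟨x, rfl⟩ := this
      exact ⟨x, hyS, rfl⟩
    · rintro ⟨x, hx, rfl⟩
      exact ⟨U.orderEmbOfFin_mem hU x, hx⟩
  rcases le_total (n 0) #S with h | h
  · obtain ⟨U, hUS, hU⟩ := Finset.exists_subset_card_eq h
    have := key U hU
    rw [inter_eq_left.2 hUS] at this
    omega
  · obtain ⟨U, hSU, -, hU⟩ := Finset.exists_subsuperset_card_eq (subset_univ S) h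
      (by simpa using hmin j)
    have := key U hU
    rwa [inter_eq_right.2 hSU] at this

/-- Double counting of the transversals meeting `S`, stated without division. -/
theorem card_filter_coord_mem (j : Fin (r + 2)) (S : Finset (Fin (n j))) :
    n j * #{f : ∀ i, Fin (n i) | f j ∈ S} = #S * ∏ i, n i := by
  have : ({f : ∀ i, Fin (n i) | f j ∈ S} : Finset _) =
      Fintype.piFinset (update (fun _ => univ) j S) := by
    ext f
    simp only [mem_filter, mem_univ, true_and, Fintype.mem_piFinset]
    constructor
    · intro h i
      by_cases hi : i = j
      · subst hi; simpa using h
      · simp [hi]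
    · intro h
      simpa using h j
  rw [this, Fintype.card_piFinset, ← Finset.mul_prod_erase _ _ (mem_univ j),
    ← Finset.mul_prod_erase _ n (mem_univ j), update_self]
  have : ∏ i ∈ univ.erase j, #(update (fun i => (univ : Finset (Fin (n i)))) j S i) =
      ∏ i ∈ univ.erase j, n i :=
    Finset.prod_congr rfl fun i hi => by simp [(mem_erase.1 hi).1]
  rw [this]
  ring

/-- A colour occurring in every perfect matching forces the extremal structure: representatives of
the remaining colours meet every perfect matching in exactly `k - 2` edges. -/
theorem isStarColoring_of_common_color (hmin : ∀ i, n 0 ≤ n i) (hk : 3 ≤ k)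
    (h0 : 2 * k - 1 ≤ n 0) (hc : RainbowFree c k)
    (hcol : (k - 2) * ∏ i : Fin (r + 1), n i.succ + 1 ≤ #(univ.image c)) {a : ℕ}
    (ha : ∀ σ : Fin (n 0) → ∀ i, Fin (n i), CoordInjective σ → ∃ x, c (σ x) = a) :
    IsStarColoring c k ∧ #(univ.image c) ≤ (k - 2) * ∏ i : Fin (r + 1), n i.succ + 1 := by
  have : ∀ i, NeZero (n i) := fun i => ⟨by have := hmin i; omega⟩
  have hprod : (k - 2) * ∏ i, n i = n 0 * ((k - 2) * ∏ i : Fin (r + 1), n i.succ) := by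
    rw [Fin.prod_univ_succ]; ring
  set N := (k - 2) * ∏ i : Fin (r + 1), n i.succ with hN
  obtain ⟨σ₀, hσ₀⟩ := exists_coordInjective hmin
  have hle : ∀ B : Finset (∀ i, Fin (n i)), Set.InjOn c B → (∀ f ∈ B, c f ≠ a) →
      ∀ σ : Fin (n 0) → ∀ i, Fin (n i), CoordInjective σ → #{x | σ x ∈ B} ≤ k - 2 := by
    intro B hB hBa σ hσ
    obtain ⟨x, hx⟩ := ha σ hσ
    have := hc.card_lt hσ (insert x ({x | σ x ∈ B} : Finset (Fin (n 0)))) (by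
      rw [coe_insert, Set.injOn_insert]
      · refine ⟨fun y hy z hz h => hσ 0 (congrFun (hB (by simpa using hy) (by simpa using hz) h) 0),
          ?_⟩
        rintro ⟨y, hy, hyx⟩
        exact hBa (σ y) (by simpa using hy) (hyx.trans hx)
      · intro h
        exact hBa _ (by simpa using h) hx)
    rw [card_insert_of_notMem (by
      intro h
      exact hBa _ (by simpa using h) hx)] at this
    omega
  have hconst : ∀ B : Finset (∀ i, Fin (n i)), Set.InjOn c B → (∀ f ∈ B, c f ≠ a) → N ≤ #B →
      ∀ σ : Fin (n 0) → ∀ i, Fin (n i), CoordInjective σ → #{x | σ x ∈ B} = k - 2 := by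
    intro B hB hBa hBN σ hσ
    refine card_eq_of_le_card_mul_card hσ (hle B hB hBa) ?_
    rw [hprod, Fintype.card_fin]
    exact Nat.mul_le_mul_left _ hBN
  obtain ⟨B, hB, hBim⟩ := exists_injOn_image_eq c (Finset.erase_subset a (univ.image c))
  have hBa : ∀ f ∈ B, c f ≠ a := by
    intro f hf h
    have := mem_image_of_mem c hf
    rw [hBim, h] at this
    simp at this
  have hcardB : #B = #((univ.image c).erase a) := by
    rw [← hBim, card_image_of_injOn hB]
  have hBN : N ≤ #B := by
    have := Finset.pred_card_le_card_erase (s := univ.image c) (a := a)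
    omega
  have hBN' : n 0 * #B ≤ n 0 * N := by
    rw [← hprod]
    simpa using card_mul_card_le hσ₀ (hle B hB hBa)
  have hBeq : #B = N := le_antisymm (Nat.le_of_mul_le_mul_left hBN' (by omega)) hBN
  obtain ⟨j, S, hS⟩ := exists_coord_of_card_const hmin (by omega) (hconst B hB hBa hBN)
    (by omega) (by omega)
  have hScard : #S = k - 2 := card_eq_of_card_coord_mem_const hmin (t := k - 2) (by omega) (by
    intro σ hσ
    rw [← hconst B hB hBa hBN σ hσ]
    simp [hS])
  have hnj : n j = n 0 := by
    have h1 := card_filter_coord_mem (n := n) j S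
    have h2 : ({f : ∀ i, Fin (n i) | f j ∈ S} : Finset _) = B := by ext f; simp [hS]
    rw [h2, hBeq, hScard, hprod] at h1
    refine Nat.eq_of_mul_eq_mul_right ?_ h1
    rw [hN]
    exact Nat.mul_pos (by omega) (Finset.prod_pos fun i _ => Nat.pos_of_ne_zero (NeZero.ne _))
  have hoff : ∀ f : ∀ i, Fin (n i), f j ∉ S → c f = a := by
    intro f hf
    by_contra hfa
    have : c f ∈ B.image c := by rw [hBim]; simp [hfa]
    obtain ⟨h, hhB, hhf⟩ := mem_image.1 this
    have hhS := (hS h).1 hhB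
    -- exchange the representative `h` of the colour of `f` for `f` itself
    have hfB : f ∉ B := fun h => hf ((hS f).1 h)
    have hfB' : f ∉ B.erase h := fun h => hfB (mem_of_mem_erase h)
    have hB' : Set.InjOn c (insert f (B.erase h) : Finset _) := by
      rw [coe_insert, Set.injOn_insert (mem_coe.not.2 hfB')]
      refine ⟨hB.mono (by simp), ?_⟩
      rintro ⟨g, hg, hgf⟩
      have hg' : g ≠ h ∧ g ∈ B := by simpa [and_comm] using hg
      exact hg'.1 (hB hg'.2 hhB (hgf.trans hhf.symm))
    have hBa' : ∀ g ∈ insert f (B.erase h), c g ≠ a := by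
      intro g hg
      rcases mem_insert.1 hg with rfl | hg
      · exact hfa
      · exact hBa g (mem_of_mem_erase hg)
    have hBN' : N ≤ #(insert f (B.erase h)) := by
      rw [card_insert_of_notMem hfB', card_erase_of_mem hhB]
      omega
    -- a perfect matching through `f` which misses `h`, as it has another edge through `h j`
    obtain ⟨i, hij⟩ : ∃ i, i ≠ j := exists_ne j
    choose g hg hg' using fun i => exists_avoid ((show 3 ≤ n 0 by omega).trans (hmin i)) (f i) (h i)
    obtain ⟨σ, hσ, hσf, hσg⟩ := exists_coordInjective_of_ne hmin
      (x := ⟨0, by omega⟩) (x' := ⟨1, by omega⟩) (by simp) (e := f) (f := update g j (h j)) (by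
        intro i
        by_cases hi : i = j
        · subst hi
          simp only [update_self]
          intro h'
          exact hf (h' ▸ hhS)
        · simpa [hi] using (hg i).symm)
    have hσh : ∀ x, σ x ≠ h := by
      intro x hx
      have : x = ⟨1, by omega⟩ := hσ j (by simp [hx, hσg])
      rw [this] at hx
      rw [hx] at hσg
      have := congrFun hσg i
      simp only [update_of_ne hij] at this
      exact hg' i this.symm
    have h1 := hconst B hB hBa hBN σ hσ
    have h2 := hconst _ hB' hBa' hBN' σ hσ
    have h3 : ({x | σ x ∈ insert f (B.erase h)} : Finset (Fin (n 0))) =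
        insert ⟨0, by omega⟩ ({x | σ x ∈ B} : Finset (Fin (n 0))) := by
      ext x
      simp only [mem_filter, mem_univ, true_and, mem_insert, mem_erase, ne_eq, hσh, not_false_eq_true]
      refine or_congr_left ⟨fun hx => hσ j ?_, fun hx => ?_⟩
      · simp only [hσf, hx]
      · rw [hx, hσf]
    rw [h3, card_insert_of_notMem (by
      simp only [mem_filter, mem_univ, true_and, hσf]
      exact hfB)] at h2
    omega
  refine ⟨⟨j, a, S, hnj, hScard, hoff, ?_⟩, ?_⟩
  · intro f g hf hfg
    have hfB := (hS f).2 hf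
    refine hB hfB ((hS g).2 ?_) hfg
    by_contra hg
    exact hBa f hfB (hfg.trans (hoff g hg))
  · have := Finset.pred_card_le_card_erase (s := univ.image c) (a := a)
    omega

end Star

/-! ### Exchanges in a bipartite matching -/

section Bipartite

/-- The points of `X` at which `d` takes a value it takes nowhere else. -/
def uniquePoints {X : Type*} [Fintype X] [DecidableEq X] (d : X → ℕ) : Finset X :=
  {x | ∀ z, d z = d x → z = x}

/-- The points of `X` whose fibre under `d` has exactly two elements. -/
def doublePoints {X : Type*} [Fintype X] [DecidableEq X] (d : X → ℕ) : Finset X :=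
  {x | #{z | d z = d x} = 2}

section Fibres

variable {X : Type*} [Fintype X] [DecidableEq X] (d : X → ℕ)

/-- A fibre has one unique point, two double points, or neither. -/
theorem two_mul_card_uniquePoints_add_le :
    2 * #(uniquePoints d) + #(doublePoints d) ≤ 2 * #(univ.image d) := by
  have h1 : #(uniquePoints d) = ∑ y ∈ univ.image d, #{x ∈ uniquePoints d | d x = y} :=
    Finset.card_eq_sum_card_fiberwise fun x _ => by simp
  have h2 : #(doublePoints d) = ∑ y ∈ univ.image d, #{x ∈ doublePoints d | d x = y} :=
    Finset.card_eq_sum_card_fiberwise fun x _ => by simp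
  rw [h1, h2, Finset.mul_sum, ← Finset.sum_add_distrib, mul_comm, ← smul_eq_mul]
  refine Finset.sum_le_card_nsmul _ _ _ fun y _ => ?_
  by_cases hy : ∃ x ∈ doublePoints d, d x = y
  · obtain ⟨x, hx, rfl⟩ := hy
    have hx' : #{z | d z = d x} = 2 := by simpa [doublePoints] using hx
    have h3 : #{z ∈ uniquePoints d | d z = d x} = 0 := by
      rw [card_eq_zero, filter_eq_empty_iff]
      intro z hz hzx
      have : ({w | d w = d x} : Finset X) ⊆ {z} := by
        intro w hw
        simp only [uniquePoints, mem_filter, mem_univ, true_and] at hz hw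
        simpa using hz w (hw.trans hzx.symm)
      have := card_le_card this
      simp only [card_singleton] at this
      omega
    have h4 : #{z ∈ doublePoints d | d z = d x} ≤ 2 := by
      rw [← hx']
      exact card_le_card (filter_subset_filter _ (subset_univ _))
    omega
  · have h3 : #{z ∈ doublePoints d | d z = y} = 0 := by
      rw [card_eq_zero, filter_eq_empty_iff]
      exact fun z hz hzy => hy ⟨z, hz, hzy⟩
    have h4 : #{z ∈ uniquePoints d | d z = y} ≤ 1 := by
      rw [card_le_one]
      intro z hz w hw
      simp only [uniquePoints, mem_filter, mem_univ, true_and] at hz hw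
      exact hw.1 z (hz.2.trans hw.2.symm)
    omega

/-- The values lost by removing two points. -/
theorem card_image_le_card_image_erase_erase (x x' : X) (hxx : x ≠ x') :
    #(univ.image d) ≤ #(((univ.erase x).erase x').image d) +
      ((if x ∈ uniquePoints d then 1 else 0) + (if x' ∈ uniquePoints d then 1 else 0) +
        (if d x' = d x ∧ x ∈ doublePoints d then 1 else 0)) := by
  set A := ((univ.erase x).erase x').image d
  -- a value lost at `x` is unique or taken only at `x` and `x'`
  have hx : d x ∉ A → x ∈ uniquePoints d ∨ (d x' = d x ∧ x ∈ doublePoints d) := by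
    intro h
    have h' : ∀ z, d z = d x → z = x ∨ z = x' := by
      intro z hz
      by_contra! hne
      exact h (mem_image.2 ⟨z, by simp [hne], hz⟩)
    by_cases hd : d x' = d x
    · refine Or.inr ⟨hd, ?_⟩
      have : ({z | d z = d x} : Finset X) = {x, x'} := by
        ext z
        simp only [mem_filter, mem_univ, true_and, mem_insert, mem_singleton]
        exact ⟨h' z, by rintro (rfl | rfl) <;> simp [hd]⟩
      simp [doublePoints, this, card_pair hxx]
    · left
      simp only [uniquePoints, mem_filter, mem_univ, true_and]
      intro z hz
      rcases h' z hz with h | rfl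
      · exact h
      · exact absurd hz hd
  have hx' : d x' ∉ A → x' ∈ uniquePoints d ∨ d x' = d x := by
    intro h
    by_cases hd : d x' = d x
    · exact Or.inr hd
    · left
      simp only [uniquePoints, mem_filter, mem_univ, true_and]
      intro z hz
      by_contra hne
      refine h (mem_image.2 ⟨z, ?_, hz⟩)
      simp only [mem_erase, mem_univ, and_true]
      exact ⟨hne, by rintro rfl; exact hd hz.symm⟩
  have hsub : univ.image d ⊆ insert (d x) (insert (d x') A) := by
    intro y hy
    obtain ⟨z, -, rfl⟩ := mem_image.1 hy
    by_cases h1 : z = x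
    · simp [h1]
    by_cases h2 : z = x'
    · simp [h2]
    refine mem_insert_of_mem (mem_insert_of_mem (mem_image_of_mem d ?_))
    simp [h1, h2]
  have hcard := card_le_card hsub
  by_cases h2 : d x' ∈ A
  · rw [insert_eq_of_mem h2] at hcard
    by_cases h1 : d x ∈ A
    · rw [insert_eq_of_mem h1] at hcard; omega
    · rw [card_insert_of_notMem h1] at hcard
      rcases hx h1 with h | h <;> simp only [h, if_true, and_self] <;> omega
  · by_cases hd : d x' = d x
    · rw [hd, insert_eq_of_mem (mem_insert_self _ _)] at hcard
      rw [hd] at h2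
      rw [card_insert_of_notMem h2] at hcard
      rcases hx h2 with h | h <;> simp only [h, if_true, and_self] <;> omega
    · have h3 := (hx' h2).resolve_right hd
      have h4 := card_insert_le (d x) (insert (d x') A)
      rw [card_insert_of_notMem h2] at h4
      by_cases h1 : d x ∈ A
      · rw [insert_eq_of_mem (mem_insert_of_mem h1), card_insert_of_notMem h2] at hcard
        simp only [h3, if_true]; omega
      · have h5 := (hx h1).resolve_right (fun h => hd h.1)
        simp only [h3, h5, if_true]; omega

theorem card_image_le_card_image_erase (x : X) :
    #(univ.image d) ≤ #((univ.erase x).image d) + (if x ∈ uniquePoints d then 1 else 0) := by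
  have hsub : univ.image d ⊆ insert (d x) ((univ.erase x).image d) := by
    rw [← image_insert, insert_erase (mem_univ x)]
  have hcard := card_le_card hsub
  split_ifs with h
  · exact hcard.trans (card_insert_le _ _)
  · rw [insert_eq_of_mem] at hcard
    · exact hcard
    · by_contra h1
      refine h ?_
      simp only [uniquePoints, mem_filter, mem_univ, true_and]
      intro z hz
      by_contra hne
      exact h1 (mem_image.2 ⟨z, by simp [hne], hz⟩)

end Fibres

variable {m n k : ℕ} {C : Fin m → Fin n → ℕ}

/-- No injection `Fin m → Fin n` picks `k` different colours from the array `C`. -/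
def ArrayRainbowFree (C : Fin m → Fin n → ℕ) (k : ℕ) : Prop :=
  ∀ q : Fin m → Fin n, Injective q → #(univ.image fun x => C x (q x)) < k

/-- New colours on the part of a matching that differs from a given one. -/
theorem ArrayRainbowFree.card_filter_add_card_image_lt (hC : ArrayRainbowFree C k)
    {p : Fin m → Fin n} {G : Finset (Fin m × Fin n)} (hG : Set.InjOn (uncurry C) G)
    (hGp : ∀ g ∈ G, ∀ x, C x (p x) ≠ uncurry C g) {q : Fin m → Fin n} (hq : Injective q)
    (A : Finset (Fin m)) (hA : ∀ x ∈ A, q x = p x) :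
    #{x | (x, q x) ∈ G} + #(A.image fun x => C x (p x)) < k := by
  refine lt_of_le_of_lt ?_ (hC q hq)
  rw [← card_image_of_injOn (s := ({x | (x, q x) ∈ G} : Finset (Fin m)))
    (f := fun x => C x (q x)), ← card_union_of_disjoint]
  · refine card_le_card (union_subset (image_subset_image (subset_univ _)) ?_)
    intro y hy
    obtain ⟨x, hx, rfl⟩ := mem_image.1 hy
    exact mem_image.2 ⟨x, mem_univ _, by simp [hA x hx]⟩
  · rw [disjoint_left]
    intro y hy hy'
    obtain ⟨x, hx, rfl⟩ := mem_image.1 hy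
    obtain ⟨z, hz, hzx⟩ := mem_image.1 hy'
    exact hGp (x, q x) (by simpa using hx) z hzx
  · intro x hx y hy h
    exact congrArg Prod.fst (hG (x₁ := (x, q x)) (x₂ := (y, q y)) (by simpa using hx)
      (by simpa using hy) h)

/-- Counting the colours not on a given perfect matching `p` with `k - 1` colours by the exchanges
of two edges of `p`, and of an edge of `p` for one leaving the vertices of `p`. -/
theorem ArrayRainbowFree.two_mul_card_le (hC : ArrayRainbowFree C k) {p : Fin m → Fin n}
    (hp : Injective p) (hmn : m ≤ n) (hm : 1 ≤ m) (hfull : k ≤ #(univ.image fun x => C x (p x)) + 1)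
    {G : Finset (Fin m × Fin n)} (hG : Set.InjOn (uncurry C) G)
    (hGp : ∀ g ∈ G, ∀ x, C x (p x) ≠ uncurry C g) :
    2 * #G ≤ 2 * #(uniquePoints fun x => C x (p x)) * (n - 1) +
      #(doublePoints fun x => C x (p x)) := by
  set d := fun x => C x (p x) with hd
  set w : Fin m → Fin n → ℕ := fun x y => if (x, y) ∈ G then 1 else 0 with hw
  set u : Fin m → ℕ := fun x => if x ∈ uniquePoints d then 1 else 0 with hu
  have hswap : ∀ x y, Injective fun z => Equiv.swap (p x) y (p z) := fun x y =>
    (Equiv.injective _).comp hp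
  have hdiag : ∀ x, w x (p x) = 0 := by
    intro x
    simp only [hw, ite_eq_right_iff]
    intro h
    exact absurd rfl (hGp _ h x)
  have hout : ∀ x y, (∀ z, p z ≠ y) → w x y ≤ u x := by
    intro x y hy
    have h1 := hC.card_filter_add_card_image_lt hG hGp (hswap x y) (univ.erase x) (by
      intro z hz
      exact Equiv.swap_apply_of_ne_of_ne (fun h => (mem_erase.1 hz).1 (hp h)) (hy z))
    change _ + #((univ.erase x).image d) < k at h1
    have h2 := card_image_le_card_image_erase d x
    have h3 : w x y ≤ #{z | (z, Equiv.swap (p x) y (p z)) ∈ G} := by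
      simp only [hw]
      split_ifs with h
      · exact card_pos.2 ⟨x, by simpa using h⟩
      · simp
    simp only [hu]
    omega
  have hpair : ∀ x x', x ≠ x' → w x (p x') + w x' (p x) ≤ u x + u x' +
      (if d x' = d x ∧ x ∈ doublePoints d then 1 else 0) := by
    intro x x' hxx
    have h1 := hC.card_filter_add_card_image_lt hG hGp (hswap x (p x')) ((univ.erase x).erase x') (by
      intro z hz
      simp only [mem_erase, mem_univ, and_true] at hz
      exact Equiv.swap_apply_of_ne_of_ne (fun h => hz.2 (hp h)) (fun h => hz.1 (hp h)))
    change _ + #(((univ.erase x).erase x').image d) < k at h1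
    have h2 := card_image_le_card_image_erase_erase d x x' hxx
    have h3 : w x (p x') + w x' (p x) ≤ #{z | (z, Equiv.swap (p x) (p x') (p z)) ∈ G} := by
      rw [card_filter, ← Finset.add_sum_erase _ _ (mem_univ x),
        ← Finset.add_sum_erase _ _ (show x' ∈ univ.erase x by simp [hxx.symm])]
      simp only [Equiv.swap_apply_left, Equiv.swap_apply_right, hw]
      omega
    simp only [hu]
    omega
  have hcardG : #G = ∑ x, ∑ y, w x y := by
    rw [← Finset.sum_product', Finset.univ_product_univ]
    simp [hw]
  have hcardU : #(uniquePoints d) = ∑ x, u x := by simp [hu]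
  have hsplit : ∀ x, ∑ y, w x y =
      ∑ x' ∈ univ.erase x, w x (p x') + ∑ y ∈ univ \ univ.image p, w x y := by
    intro x
    rw [← Finset.sum_sdiff (subset_univ (univ.image p)), add_comm, sum_image hp.injOn,
      ← Finset.add_sum_erase _ _ (mem_univ x), hdiag, zero_add]
  have hB : ∑ x, ∑ y ∈ univ \ univ.image p, w x y ≤ #(uniquePoints d) * (n - m) := by
    rw [hcardU, Finset.sum_mul]
    refine Finset.sum_le_sum fun x _ => ?_
    refine (Finset.sum_le_card_nsmul _ _ (u x) fun y hy => hout x y ?_).trans ?_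
    · intro z hz
      simp only [mem_sdiff, mem_univ, mem_image, true_and] at hy
      exact hy ⟨z, hz⟩
    · rw [card_sdiff_of_subset (subset_univ _), card_image_of_injective _ hp]
      simp [mul_comm]
  have hA : 2 * ∑ x, ∑ x' ∈ univ.erase x, w x (p x') ≤
      2 * #(uniquePoints d) * (m - 1) + #(doublePoints d) := by
    have hcomm : ∀ F : Fin m → Fin m → ℕ, ∑ x, ∑ x' ∈ univ.erase x, F x x' =
        ∑ x, ∑ x' ∈ univ.erase x, F x' x := by
      intro F
      refine Finset.sum_comm' ?_
      intro x y
      simp [eq_comm]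
    have h1 : 2 * ∑ x, ∑ x' ∈ univ.erase x, w x (p x') =
        ∑ x, ∑ x' ∈ univ.erase x, (w x (p x') + w x' (p x)) := by
      simp only [Finset.sum_add_distrib]
      rw [← hcomm, two_mul]
    have h2 : ∑ x, ∑ x' ∈ univ.erase x, (u x + u x') = 2 * #(uniquePoints d) * (m - 1) := by
      simp only [Finset.sum_add_distrib]
      rw [← hcomm fun x _ => u x, ← two_mul]
      simp only [sum_const, card_erase_of_mem (mem_univ _), card_univ, Fintype.card_fin,
        smul_eq_mul]
      rw [← Finset.mul_sum, hcardU]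
      ring
    have h3 : ∑ x, ∑ x' ∈ univ.erase x, (if d x' = d x ∧ x ∈ doublePoints d then 1 else 0) ≤
        #(doublePoints d) := by
      have : #(doublePoints d) = ∑ x, if x ∈ doublePoints d then 1 else 0 := by simp
      rw [this]
      refine Finset.sum_le_sum fun x _ => ?_
      split_ifs with hx
      · simp only [hx, and_true]
        rw [← card_filter, filter_erase, card_erase_of_mem (by simp)]
        have : #{z | d z = d x} = 2 := by simpa [doublePoints] using hx
        omega
      · simp [hx]
    rw [h1, ← h2]
    refine le_trans ?_ (Nat.add_le_add_left h3 _)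
    rw [← Finset.sum_add_distrib]
    refine Finset.sum_le_sum fun x _ => ?_
    rw [← Finset.sum_add_distrib]
    refine Finset.sum_le_sum fun x' hx' => hpair x x' (mem_erase.1 hx').1.symm
  have hG' : #G = ∑ x, ∑ x' ∈ univ.erase x, w x (p x') +
      ∑ x, ∑ y ∈ univ \ univ.image p, w x y := by
    rw [hcardG, ← Finset.sum_add_distrib]
    exact Finset.sum_congr rfl fun x _ => hsplit x
  have hn1 : n - 1 = (m - 1) + (n - m) := by omega
  rw [hn1, hG', mul_add, mul_add]
  have : 2 * #(uniquePoints d) * (n - m) = 2 * (#(uniquePoints d) * (n - m)) := by ring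
  omega

end Bipartite

/-! ### The common colour for two classes -/

section BipartiteStructure

variable {m n k : ℕ} {C : Fin m → Fin n → ℕ}

/-- A perfect matching with `k - 1` colours has `k - 2` edges of colours of their own, and all its
other edges have one colour. -/
theorem ArrayRainbowFree.exists_unique_structure (hC : ArrayRainbowFree C k) (hk : 3 ≤ k)
    (hm : 2 * k - 1 ≤ m) (hmn : m ≤ n) (hcol : (k - 2) * n + 1 ≤ #(univ.image (uncurry C)))
    {p : Fin m → Fin n} (hp : Injective p) (hfull : k ≤ #(univ.image fun x => C x (p x)) + 1) :
    ∃ a, #(uniquePoints fun x => C x (p x)) = k - 2 ∧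
      ∀ x, x ∉ uniquePoints (fun x => C x (p x)) ↔ C x (p x) = a := by
  set d := fun x => C x (p x) with hd
  have hdk := hC p hp
  change #(univ.image d) < k at hdk
  obtain ⟨G, hG, hGim⟩ := exists_injOn_image_eq (uncurry C)
    (t := univ.image (uncurry C) \ univ.image d) sdiff_subset
  have hGp : ∀ g ∈ G, ∀ x, C x (p x) ≠ uncurry C g := by
    intro g hg x hx
    have := mem_image_of_mem (uncurry C) hg
    rw [hGim, ← hx] at this
    exact (mem_sdiff.1 this).2 (mem_image_of_mem d (mem_univ x))
  have hcount := hC.two_mul_card_le hp hmn (by omega) hfull hG hGp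
  change 2 * #G ≤ 2 * #(uniquePoints d) * (n - 1) + #(doublePoints d) at hcount
  have hGcard : #(univ.image (uncurry C)) ≤ #G + #(univ.image d) := by
    rw [← card_image_of_injOn hG, hGim]
    have := card_le_card_sdiff_add_card (s := univ.image (uncurry C)) (t := univ.image d)
    omega
  have hD := two_mul_card_uniquePoints_add_le d
  -- the values taken more than once
  set R := (univ.image d) \ (uniquePoints d).image d with hR
  have hUinj : Set.InjOn d (uniquePoints d) := by
    intro x hx y hy h
    simp only [uniquePoints, coe_filter, mem_univ, true_and, Set.mem_ofPred_eq] at hy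
    exact hy x h
  have hRcard : #R + #(uniquePoints d) = #(univ.image d) := by
    rw [hR, card_sdiff_of_subset (image_subset_image (subset_univ _)), card_image_of_injOn hUinj]
    have := card_le_card (image_subset_image (f := d) (subset_univ (uniquePoints d)))
    rw [card_image_of_injOn hUinj] at this
    omega
  have hRpos : 1 ≤ #R := by
    by_contra h
    have h1 : #(uniquePoints d) ≤ #(univ.image d) := by omega
    have h2 : uniquePoints d ≠ univ := by
      intro h
      rw [h, card_univ, Fintype.card_fin] at h1
      omega
    obtain ⟨x, hx⟩ := not_forall.1 fun h => h2 (eq_univ_iff_forall.2 h)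
    have hxR : d x ∈ R := by
      simp only [hR, mem_sdiff, mem_image, mem_univ, true_and, not_exists, not_and,
        exists_apply_eq_apply]
      intro z hz hzx
      simp only [uniquePoints, mem_filter, mem_univ, true_and] at hz
      have := hz x hzx.symm
      subst this
      exact hx (by simpa [uniquePoints] using hz)
    exact h (card_pos.2 ⟨_, hxR⟩)
  -- with `q + 1` such values the total number of colours would fall short by about `q * n`
  have hR1 : #R = 1 := by
    obtain ⟨q, hq⟩ : ∃ q, #R = q + 1 := ⟨#R - 1, by omega⟩
    have hk2 : k - 2 = q + #(uniquePoints d) := by omega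
    rw [hk2] at hcol
    set t := #(uniquePoints d)
    obtain ⟨n', rfl⟩ : ∃ n', n = n' + 1 := ⟨n - 1, by omega⟩
    rw [Nat.add_sub_cancel] at hcount
    have h1 : 2 * ((q + t) * (n' + 1) + 1) ≤
        2 * t * n' + 2 * (k - 1) + (2 * (k - 1) - 2 * t) := by omega
    have h2 : k - 1 = q + t + 1 := by omega
    rw [h2] at h1
    have h3 : 2 * (q + t + 1) ≤ n' := by omega
    rcases Nat.eq_zero_or_pos q with h | h
    · omega
    · have h4 : q * 4 ≤ q * n' := Nat.mul_le_mul_left q (by omega)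
      have h5 : 2 * ((q + t) * (n' + 1) + 1) = 2 * (q * n') + 2 * q + 2 * t * n' + 2 * t + 2 := by
        ring
      omega
  obtain ⟨a, ha⟩ := card_eq_one.1 hR1
  refine ⟨a, by omega, fun x => ?_⟩
  have hxa : C x (p x) = a ↔ d x ∈ R := by rw [ha, mem_singleton]
  rw [hxa]
  simp only [hR, mem_sdiff, mem_image, mem_univ, true_and, exists_apply_eq_apply, not_exists,
    not_and]
  constructor
  · intro hx z hz hzx
    simp only [uniquePoints, mem_filter, mem_univ, true_and] at hz
    have := hz x hzx.symm
    subst this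
    exact hx (by simpa [uniquePoints] using hz)
  · intro h hx
    exact h x hx rfl

/-- Counting by the translates of an injection, some of them has at least the average number of
colours. -/
theorem exists_injective_le_card_image (hmn : m ≤ n) {t : ℕ}
    (hcol : t * n < #(univ.image (uncurry C))) :
    ∃ p : Fin m → Fin n, Injective p ∧ t < #(univ.image fun x => C x (p x)) := by
  rcases Nat.eq_zero_or_pos n with rfl | hn
  · simp at hcol
  have : NeZero n := ⟨hn.ne'⟩
  obtain ⟨G, hG, hGim⟩ := exists_injOn_image_eq (uncurry C) Subset.rfl
  rw [← hGim, card_image_of_injOn hG] at hcol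
  obtain ⟨s, -, hs⟩ := Finset.exists_lt_card_fiber_of_mul_lt_card_of_maps_to (s := G)
    (t := (univ : Finset (Fin n))) (f := fun g => g.2 - Fin.castLE hmn g.1) (n := t)
    (fun _ _ => mem_univ _) (by simpa [mul_comm] using hcol)
  refine ⟨fun x => s + Fin.castLE hmn x, fun x y h => Fin.castLE_injective hmn (add_left_cancel h),
    hs.trans_le ?_⟩
  rw [← card_image_of_injOn (hG.mono (filter_subset _ _))]
  refine card_le_card fun y hy => ?_
  obtain ⟨g, hg, rfl⟩ := mem_image.1 hy
  refine mem_image.2 ⟨g.1, mem_univ _, ?_⟩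
  simp only [← (mem_filter.1 hg).2, sub_add_cancel]
  rfl

/-- All entries outside the rows and columns of the uniquely coloured edges of a perfect matching
with `k - 1` colours have the same colour. -/
theorem ArrayRainbowFree.exists_common_color (hC : ArrayRainbowFree C k) (hk : 3 ≤ k)
    (hm : 2 * k - 1 ≤ m) (hmn : m ≤ n) (hcol : (k - 2) * n + 1 ≤ #(univ.image (uncurry C))) :
    ∃ (a : ℕ) (S : Finset (Fin m)) (T : Finset (Fin n)), #S = k - 2 ∧ #T = k - 2 ∧
      ∀ x y, x ∉ S → y ∉ T → C x y = a := by
  obtain ⟨p, hp, hpk⟩ := exists_injective_le_card_image hmn hcol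
  have hfull : k ≤ #(univ.image fun x => C x (p x)) + 1 := by omega
  obtain ⟨a, hS, ha⟩ := hC.exists_unique_structure hk hm hmn hcol hp hfull
  set S := uniquePoints fun x => C x (p x) with hSdef
  refine ⟨a, S, S.image p, hS, by rw [card_image_of_injective _ hp, hS], fun x y hx hy => ?_⟩
  -- exchange `(x, p x)` for `(x, y)`; no edge of a unique colour changes
  set q := fun z => Equiv.swap (p x) y (p z) with hq
  have hqinj : Injective q := (Equiv.injective _).comp hp
  have hqx : q x = y := Equiv.swap_apply_left _ _
  have hqS : ∀ z ∈ S, q z = p z := fun z hz => Equiv.swap_apply_of_ne_of_ne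
    (fun h => hx (hp h ▸ hz)) (fun h => hy (mem_image.2 ⟨z, hz, h⟩))
  -- two edges of colour `a` remain
  have hbad : #(insert x (S ∪ ({z | p z = y} : Finset (Fin m)))) + 2 ≤ m := by
    have h1 := card_insert_le x (S ∪ ({z | p z = y} : Finset (Fin m)))
    have h2 := card_union_le S ({z | p z = y} : Finset (Fin m))
    have h3 : #({z | p z = y} : Finset (Fin m)) ≤ 1 := by
      rw [card_le_one]
      intro z hz w hw
      simp only [mem_filter, mem_univ, true_and] at hz hw
      exact hp (hz.trans hw.symm)
    omega
  obtain ⟨z, z', hzz, hz, hz'⟩ : ∃ z z', z ≠ z' ∧ C z (q z) = a ∧ C z' (q z') = a := by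
    have h1 : 1 < #(insert x (S ∪ ({z | p z = y} : Finset (Fin m))))ᶜ := by
      rw [card_compl, Fintype.card_fin]; omega
    obtain ⟨z, hz, z', hz', hzz⟩ := one_lt_card.1 h1
    have key : ∀ z ∈ (insert x (S ∪ ({z | p z = y} : Finset (Fin m))))ᶜ, C z (q z) = a := by
      intro z hz
      simp only [mem_compl, mem_insert, mem_union, mem_filter, mem_univ, true_and, not_or] at hz
      have : q z = p z := Equiv.swap_apply_of_ne_of_ne (fun h => hz.1 (hp h)) hz.2.2
      rw [this]
      exact (ha z).1 hz.2.1
    exact ⟨z, z', hzz, key z hz, key z' hz'⟩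
  have hqfull : k ≤ #(univ.image fun x => C x (q x)) + 1 := by
    refine hfull.trans (Nat.add_le_add_right (card_le_card ?_) 1)
    intro v hv
    obtain ⟨w, -, rfl⟩ := mem_image.1 hv
    by_cases hw : w ∈ S
    · exact mem_image.2 ⟨w, mem_univ _, by simp only [hqS w hw]⟩
    · exact mem_image.2 ⟨z, mem_univ _, by simp only [hz, (ha w).1 hw]⟩
  obtain ⟨b, hS', hb⟩ := hC.exists_unique_structure hk hm hmn hcol hqinj hqfull
  set S' := uniquePoints fun x => C x (q x) with hSdef'
  have hba : b = a := by
    rw [← hz, eq_comm, ← hb z]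
    intro h
    simp only [hSdef', uniquePoints, mem_filter, mem_univ, true_and] at h
    exact hzz (h z' (hz'.trans hz.symm)).symm
  have hSS : S ⊆ S' := by
    intro w hw
    by_contra hw'
    have := (hb w).1 hw'
    rw [hqS w hw, hba] at this
    exact (ha w).2 this hw
  have hSeq : S = S' := eq_of_subset_of_card_le hSS (by omega)
  have := (hb x).1 (hSeq ▸ hx)
  rwa [hqx, hba] at this

variable {n : Fin 2 → ℕ} {c : (∀ i, Fin (n i)) → ℕ}

theorem exists_common_color_two (hmin : ∀ i, n 0 ≤ n i) (hk : 3 ≤ k) (h0 : 2 * k - 1 ≤ n 0)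
    (hc : RainbowFree c k) (hcol : (k - 2) * ∏ i : Fin 1, n i.succ + 1 ≤ #(univ.image c)) :
    ∃ a, ∀ σ : Fin (n 0) → ∀ i, Fin (n i), CoordInjective σ → ∃ x, c (σ x) = a := by
  set E : Fin (n 0) → Fin (n 1) → ∀ i, Fin (n i) :=
    fun x y => Fin.cons x (Fin.cons y finZeroElim) with hE
  have hEs : ∀ f : ∀ i, Fin (n i), E (f 0) (f 1) = f := by
    intro f
    funext i
    fin_cases i <;> rfl
  have hC : ArrayRainbowFree (fun x y => c (E x y)) k := by
    intro q hq
    refine hc.card_image_lt (σ := fun x => E x (q x)) ?_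
    intro i
    fin_cases i
    · exact injective_id
    · exact hq
  have him : univ.image (uncurry fun x y => c (E x y)) = univ.image c := by
    ext v
    simp only [mem_image, mem_univ, true_and, Prod.exists, uncurry_apply_pair]
    exact ⟨fun ⟨x, y, h⟩ => ⟨_, h⟩, fun ⟨f, h⟩ => ⟨f 0, f 1, by rw [hEs, h]⟩⟩
  obtain ⟨a, S, T, hS, hT, ha⟩ := hC.exists_common_color hk h0 (hmin 1) (by
    rw [him]; simpa using hcol)
  refine ⟨a, fun σ hσ => ?_⟩
  obtain ⟨x, hx, hx'⟩ := exists_coord_notMem (r := 0) hσ 0 1 S T (by omega)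
  have := ha _ _ hx hx'
  rw [hEs] at this
  exact ⟨x, this⟩

end BipartiteStructure

/-! ### Merging two classes -/

section Merge

variable {r : ℕ} {n : Fin (r + 3) → ℕ} {k : ℕ} {c : (∀ i, Fin (n i)) → ℕ}

/-- The transversal whose vertex in the last class is matched by `τ` to its vertex in the first. -/
def extendBy (n : Fin (r + 3) → ℕ) (τ : Fin (n 0) → Fin (n (Fin.last _)))
    (f : ∀ i : Fin (r + 2), Fin (n i.castSucc)) : ∀ i, Fin (n i) :=
  Fin.snoc (α := fun i => Fin (n i)) f (τ (f 0))

theorem extendBy_castSucc (τ : Fin (n 0) → Fin (n (Fin.last _)))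
    (f : ∀ i : Fin (r + 2), Fin (n i.castSucc)) (i : Fin (r + 2)) :
    extendBy n τ f i.castSucc = f i := by
  simp [extendBy]

theorem extendBy_last (τ : Fin (n 0) → Fin (n (Fin.last _)))
    (f : ∀ i : Fin (r + 2), Fin (n i.castSucc)) : extendBy n τ f (Fin.last _) = τ (f 0) := by
  simp [extendBy]

theorem CoordInjective.extendBy {τ : Fin (n 0) → Fin (n (Fin.last _))} (hτ : Injective τ)
    {X : Type*} {e : X → ∀ i : Fin (r + 2), Fin (n i.castSucc)} (he : CoordInjective e) :
    CoordInjective fun x => extendBy n τ (e x) := by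
  intro i
  induction i using Fin.lastCases with
  | last =>
    simp only [extendBy_last]
    exact hτ.comp (he 0)
  | cast i => simpa only [extendBy_castSucc] using he i

theorem RainbowFree.extendBy (hc : RainbowFree c k) {τ : Fin (n 0) → Fin (n (Fin.last _))}
    (hτ : Injective τ) : RainbowFree (fun f => c (extendBy n τ f)) k :=
  fun _ he => hc _ (he.extendBy hτ)

/-- Some of the hypergraphs obtained by merging the first and the last class along a translate of
an injection has at least the average number of colours. -/
theorem exists_injective_le_card_image_extendBy (hlast : n 0 ≤ n (Fin.last _)) {t : ℕ}
    (hcol : t * n (Fin.last _) < #(univ.image c)) :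
    ∃ τ : Fin (n 0) → Fin (n (Fin.last _)), Injective τ ∧
      t < #(univ.image fun f => c (extendBy n τ f)) := by
  obtain ⟨G, hG, hGim⟩ := exists_injOn_image_eq c Subset.rfl
  rw [← hGim, card_image_of_injOn hG] at hcol
  have hpos : n (Fin.last _) ≠ 0 := by
    intro h
    obtain ⟨g, -⟩ := card_pos.1 (Nat.zero_lt_of_lt hcol)
    exact (Fin.cast h (g (Fin.last _))).elim0
  have : NeZero (n (Fin.last _)) := ⟨hpos⟩
  obtain ⟨s, -, hs⟩ := Finset.exists_lt_card_fiber_of_mul_lt_card_of_maps_to (s := G)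
    (t := (univ : Finset (Fin (n (Fin.last _)))))
    (f := fun g => g (Fin.last _) - Fin.castLE hlast (g 0)) (n := t)
    (fun _ _ => mem_univ _) (by simpa [mul_comm] using hcol)
  refine ⟨fun x => s + Fin.castLE hlast x,
    fun x y h => Fin.castLE_injective hlast (add_left_cancel h), hs.trans_le ?_⟩
  rw [← card_image_of_injOn (hG.mono (filter_subset _ _))]
  refine card_le_card fun y hy => ?_
  obtain ⟨g, hg, rfl⟩ := mem_image.1 hy
  refine mem_image.2 ⟨fun i => g i.castSucc, mem_univ _, congrArg c ?_⟩
  funext i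
  induction i using Fin.lastCases with
  | last =>
    rw [extendBy_last, ← (mem_filter.1 hg).2]
    exact sub_add_cancel _ _
  | cast i => rw [extendBy_castSucc]

theorem exists_injective_avoid {m : ℕ} {X : Type*} [Fintype X] (F : Finset (Fin m))
    (h : Fintype.card X + #F ≤ m) : ∃ u : X → Fin m, Injective u ∧ ∀ x, u x ∉ F := by
  have : Fintype.card X ≤ Fintype.card {y // y ∉ F} := by
    rw [Fintype.card_subtype_compl, Fintype.card_fin, Fintype.card_coe]
    omega
  obtain ⟨u⟩ := Function.Embedding.nonempty_of_card_le this
  exact ⟨fun x => u x, Subtype.val_injective.comp u.injective, fun x => (u x).2⟩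

/-- If the merged hypergraph has a star colouring, then a rainbow `k`-matching arises from an edge
`g` of an unexpected colour, `k - 2` edges of the star and an edge of the common colour. -/
theorem eq_common_color_of_notMem (hmin : ∀ i, n 0 ≤ n i) (hk : 3 ≤ k) (h0 : 2 * k - 1 ≤ n 0)
    (hc : RainbowFree c k) {τ : Fin (n 0) → Fin (n (Fin.last _))} (hτ : Injective τ)
    {j : Fin (r + 2)} {a : ℕ} {S : Finset (Fin (n j.castSucc))} (hS : #S = k - 2)
    (hoff : ∀ f, f j ∉ S → c (extendBy n τ f) = a)
    (hon : ∀ f g, f j ∈ S → c (extendBy n τ f) = c (extendBy n τ g) → f = g)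
    {g : ∀ i, Fin (n i)} (hgS : g j.castSucc ∉ S)
    (hgT : ∀ f : ∀ i : Fin (r + 2), Fin (n i.castSucc), j = 0 → f j ∈ S →
      τ (f 0) ≠ g (Fin.last _)) : c g = a := by
  by_contra hga
  set g' : ∀ i : Fin (r + 2), Fin (n i.castSucc) := fun i => g i.castSucc with hg'
  -- `z 0` is the vertex merged with the last vertex of `g`
  obtain ⟨z, hzS, hz⟩ : ∃ z : ∀ i : Fin (r + 2), Fin (n i.castSucc), z j ∉ S ∧
      ∀ x : Fin (n 0), x ≠ z 0 → τ x ≠ g (Fin.last _) := by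
    by_cases h : ∃ x, τ x = g (Fin.last _)
    · obtain ⟨x, hx⟩ := h
      obtain ⟨z, hz0, hz⟩ : ∃ z : ∀ i : Fin (r + 2), Fin (n i.castSucc),
          z 0 = x ∧ ∀ i, i ≠ 0 → z i = g' i :=
        ⟨update g' 0 x, update_self .., fun i hi => update_of_ne hi ..⟩
      refine ⟨z, ?_, fun y hy hyx => hy ((hτ (hyx.trans hx.symm)).trans hz0.symm)⟩
      by_cases hj : j = 0
      · exact fun hxS => hgT z hj hxS (by rw [hz0, hx])
      · rw [hz j hj]
        exact hgS
    · exact ⟨g', hgS, fun x _ hx => h ⟨x, hx⟩⟩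
  -- the only edge of the star that may have the colour of `g`
  obtain ⟨h, hh⟩ : ∃ h : ∀ i : Fin (r + 2), Fin (n i.castSucc),
      ∀ f, f j ∈ S → c (extendBy n τ f) = c g → f = h := by
    by_cases H : ∃ h : ∀ i : Fin (r + 2), Fin (n i.castSucc), h j ∈ S ∧ c (extendBy n τ h) = c g
    · obtain ⟨h, hhS, hhg⟩ := H
      exact ⟨h, fun f hf hfg => hon f h hf (hfg.trans hhg.symm)⟩
    · exact ⟨g', fun f hf hfg => absurd ⟨f, hf, hfg⟩ H⟩
  have hF : ∀ i, #({g' i, h i, z i} : Finset (Fin (n i.castSucc))) ≤ 3 := fun i => card_le_three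
  have hX : Fintype.card (Option S) = k - 1 := by
    rw [Fintype.card_option, Fintype.card_coe]
    omega
  -- `some s` indexes the edge through the vertex `s` of the star, `none` the edge avoiding the star
  have hu : ∀ i : Fin (r + 2), ∃ u : Option S → Fin (n i.castSucc), Injective u ∧
      (∀ x, u x ≠ g' i) ∧ (∀ x, u x ≠ z i) ∧ (i ≠ j → ∀ x, u x ≠ h i) ∧
      ∀ hij : i = j, u none ∉ (hij ▸ S : Finset (Fin (n i.castSucc))) ∧
        ∀ s : S, u (some s) ∈ (hij ▸ S : Finset (Fin (n i.castSucc))) := by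
    intro i
    have hi := hmin i.castSucc
    have hFi := hF i
    by_cases hij : i = j
    · subst hij
      obtain ⟨y, -, hy⟩ := Finset.exists_mem_notMem_of_card_lt_card
        (s := S ∪ {g' i, h i, z i}) (t := univ) (by
          have := card_union_le S {g' i, h i, z i}
          rw [card_univ, Fintype.card_fin]
          omega)
      simp only [mem_union, mem_insert, mem_singleton, not_or] at hy
      refine ⟨fun x => x.elim y (fun s => s), ?_, ?_, ?_, fun h => absurd rfl h, ?_⟩
      · rintro (_ | s) (_ | s') hss
        · rfl
        · exact absurd s'.2 (by simp only [Option.elim] at hss; rw [← hss]; exact hy.1)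
        · exact absurd s.2 (by simp only [Option.elim] at hss; rw [hss]; exact hy.1)
        · exact congrArg some (Subtype.ext hss)
      · rintro (_ | s)
        · exact hy.2.1
        · intro h
          simp only [Option.elim] at h
          have := s.2
          rw [h] at this
          exact hgS this
      · rintro (_ | s)
        · exact hy.2.2.2
        · intro h
          simp only [Option.elim] at h
          have := s.2
          rw [h] at this
          exact hzS this
      · exact fun _ => ⟨hy.1, fun s => s.2⟩
    · obtain ⟨u, hu, huF⟩ := exists_injective_avoid (X := Option S) {g' i, h i, z i} (by omega)
      simp only [mem_insert, mem_singleton, not_or] at huF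
      exact ⟨u, hu, fun x => (huF x).1, fun x => (huF x).2.2, fun _ x => (huF x).2.1,
        fun h => absurd h hij⟩
  choose u hu hug huz huh huS using hu
  set f : Option S → ∀ i : Fin (r + 2), Fin (n i.castSucc) := fun x i => u i x with hf
  have hfco : CoordInjective f := hu
  have hfnone : f none j ∉ S := (huS j rfl).1
  have hfsome : ∀ s, f (some s) j ∈ S := (huS j rfl).2
  have hfg : ∀ s, c (extendBy n τ (f (some s))) ≠ c g := by
    intro s hs
    obtain ⟨i, hij⟩ : ∃ i, i ≠ j := exists_ne j
    exact huh i hij (some s) (congrFun (hh _ (hfsome s) hs) i)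
  have hfinj : Injective f := fun x y hxy => hfco 0 (congrFun hxy 0)
  refine hc.not_injective (X := Option (Option S))
    (σ := fun x => x.elim g fun y => extendBy n τ (f y)) ?_ ?_ ?_
  · have hco := hfco.extendBy hτ
    have hne : ∀ i y, extendBy n τ (f y) i ≠ g i := by
      intro i y
      induction i using Fin.lastCases with
      | last => rw [extendBy_last]; exact hz _ (huz 0 y)
      | cast i => rw [extendBy_castSucc]; exact hug i y
    rintro i (_ | x) (_ | y) hxy
    · rfl
    · exact absurd hxy.symm (hne i y)
    · exact absurd hxy (hne i x)
    · exact congrArg some (hco i hxy)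
  · rw [Fintype.card_option, hX]
    omega
  · rintro (_ | _ | x) (_ | _ | y) hxy
    · rfl
    · exact absurd (hxy.trans (hoff _ hfnone)) hga
    · exact absurd hxy.symm (hfg y)
    · exact absurd (hxy.symm.trans (hoff _ hfnone)) hga
    · rfl
    · exact absurd (hfinj (hon _ _ (hfsome y) hxy.symm)) (by simp)
    · exact absurd hxy (hfg x)
    · exact absurd (hfinj (hon _ _ (hfsome x) hxy)) (by simp)
    · exact congrArg some (hfinj (hon _ _ (hfsome x) hxy))

end Merge

/-- The extremal bound together with the uniqueness of the extremal colouring, for colourings of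
transversals. -/
theorem isStarColoring_of_rainbowFree {r : ℕ} {n : Fin (r + 2) → ℕ} {k : ℕ}
    {c : (∀ i, Fin (n i)) → ℕ} (hmin : ∀ i, n 0 ≤ n i) (hk : 3 ≤ k) (h0 : 2 * k - 1 ≤ n 0)
    (hc : RainbowFree c k)
    (hcol : (k - 2) * ∏ i : Fin (r + 1), n i.succ + 1 ≤ #(univ.image c)) :
    IsStarColoring c k ∧ #(univ.image c) ≤ (k - 2) * ∏ i : Fin (r + 1), n i.succ + 1 := by
  suffices H : ∃ a, ∀ σ : Fin (n 0) → ∀ i, Fin (n i), CoordInjective σ → ∃ x, c (σ x) = a by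
    obtain ⟨a, ha⟩ := H
    exact isStarColoring_of_common_color hmin hk h0 hc hcol ha
  induction r with
  | zero => exact exists_common_color_two hmin hk h0 hc hcol
  | succ r ih =>
    obtain ⟨τ, hτ, hτcol⟩ := exists_injective_le_card_image_extendBy
      (t := (k - 2) * ∏ i : Fin (r + 1), n i.succ.castSucc) (hmin (Fin.last _)) (by
        rw [Fin.prod_univ_castSucc, ← mul_assoc] at hcol
        exact hcol)
    have hcτ := hc.extendBy hτ
    have hstar : IsStarColoring (n := fun i : Fin (r + 2) => n i.castSucc)
        (fun f => c (extendBy n τ f)) k := by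
      obtain ⟨a, ha⟩ := ih (n := fun i : Fin (r + 2) => n i.castSucc) (fun i => hmin i.castSucc)
        h0 hcτ hτcol
      exact (isStarColoring_of_common_color (n := fun i : Fin (r + 2) => n i.castSucc)
        (fun i => hmin i.castSucc) hk h0 hcτ hτcol ha).1
    obtain ⟨j, a, S, -, hS, hoff, hon⟩ := hstar
    -- the vertices of the last class merged with a vertex of the star
    obtain ⟨T, hT, hTS⟩ : ∃ T : Finset (Fin (n (Fin.last _))), #T ≤ k - 2 ∧
        ∀ f : ∀ i : Fin (r + 2), Fin (n i.castSucc), j = 0 → f j ∈ S → τ (f 0) ∈ T := by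
      by_cases hj : j = 0
      · subst hj
        exact ⟨S.image τ, card_image_le.trans hS.le, fun f _ hf => mem_image_of_mem τ hf⟩
      · exact ⟨∅, by simp, fun f h => absurd h hj⟩
    refine ⟨a, fun σ hσ => ?_⟩
    obtain ⟨x, hxS, hxT⟩ := exists_coord_notMem hσ j.castSucc (Fin.last _) S T (by omega)
    exact ⟨x, eq_common_color_of_notMem hmin hk h0 hc hτ hS hoff hon hxS
      fun f hj hf h => hxT (h ▸ hTS f hj hf)⟩

/-! ### Star colourings as colourings of the hypergraph -/

section StarColoring

variable {r : ℕ} {n : Fin (r + 2) → ℕ} {k : ℕ} {c : (∀ i, Fin (n i)) → ℕ}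

theorem exists_coord_notMem_of_card_lt (hmin : ∀ i, n 0 ≤ n i) {j : Fin (r + 2)}
    {S : Finset (Fin (n j))} (hS : #S < n 0) : ∃ f : ∀ i, Fin (n i), f j ∉ S := by
  obtain ⟨σ, hσ⟩ := exists_coordInjective hmin
  obtain ⟨x, hx, -⟩ := exists_coord_notMem hσ j j S ∅ (by simpa using hS)
  exact ⟨σ x, hx⟩

theorem IsStarColoring.rainbowFree (hk : 3 ≤ k) (hc : IsStarColoring c k) : RainbowFree c k := by
  obtain ⟨j, a, S, -, hS, hoff, -⟩ := hc
  intro e he hinj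
  have h1 := card_filter_coord_mem_le he j S
  have h2 : #{s | e s j ∉ S} ≤ 1 := by
    rw [card_le_one]
    intro s hs s' hs'
    simp only [mem_filter, mem_univ, true_and] at hs hs'
    exact hinj ((hoff _ hs).trans (hoff _ hs').symm)
  have h3 := card_filter_add_card_filter_not (s := (univ : Finset (Fin k))) (fun s => e s j ∈ S)
  rw [card_univ, Fintype.card_fin] at h3
  omega

theorem IsStarColoring.card_image (hmin : ∀ i, n 0 ≤ n i) (hk : 3 ≤ k) (h0 : 2 * k - 1 ≤ n 0)
    (hc : IsStarColoring c k) :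
    #(univ.image c) = (k - 2) * ∏ i : Fin (r + 1), n i.succ + 1 := by
  obtain ⟨j, a, S, hj, hS, hoff, hon⟩ := hc
  obtain ⟨g, hg⟩ := exists_coord_notMem_of_card_lt hmin (j := j) (S := S) (by omega)
  have himage : univ.image c = insert a (({f | f j ∈ S} : Finset _).image c) := by
    ext v
    simp only [mem_image, mem_univ, true_and, mem_insert, mem_filter]
    constructor
    · rintro ⟨f, rfl⟩
      by_cases hf : f j ∈ S
      · exact Or.inr ⟨f, hf, rfl⟩
      · exact Or.inl (hoff f hf)
    · rintro (rfl | ⟨f, -, rfl⟩)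
      · exact ⟨g, hoff g hg⟩
      · exact ⟨f, rfl⟩
  have hcard := card_filter_coord_mem (n := n) j S
  rw [hS, Fin.prod_univ_succ, mul_left_comm, ← hj] at hcard
  rw [himage, card_insert_of_notMem, card_image_of_injOn, Nat.eq_of_mul_eq_mul_left (by omega) hcard]
  · intro f hf g _ hfg
    exact hon f g (by simpa using hf) hfg
  · intro ha
    obtain ⟨f, hf, hfa⟩ := mem_image.1 ha
    have hf' : f j ∈ S := by simpa using hf
    exact hg (hon f g hf' (hfa.trans (hoff g hg).symm) ▸ hf')

theorem exists_isStarColoring (h0 : 2 * k - 1 ≤ n 0) (hk : 3 ≤ k) :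
    ∃ c : (∀ i, Fin (n i)) → ℕ, IsStarColoring c k := by
  obtain ⟨S, -, hS⟩ := Finset.exists_subset_card_eq (s := (univ : Finset (Fin (n 0))))
    (n := k - 2) (by rw [card_univ, Fintype.card_fin]; omega)
  -- the colour `0` is kept for the transversals avoiding `S`
  refine ⟨fun f => if f 0 ∈ S then (Fintype.equivFin _ f : ℕ) + 1 else 0, 0, 0, S, rfl, hS,
    fun f hf => if_neg hf, fun f g hf hfg => ?_⟩
  simp only [hf, if_true] at hfg
  split_ifs at hfg
  simpa [Fin.val_inj] using hfg

end StarColoring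

section Transfer

variable {r : ℕ} {n : Fin r → ℕ}

/-- The vertex set of a transversal. -/
def transversalSet (f : ∀ i, Fin (n i)) : Set (PartVertex n) :=
  {v | f v.1 = v.2}

theorem transversalSet_inter_vertexClass (f : ∀ i, Fin (n i)) (i : Fin r) :
    transversalSet f ∩ vertexClass n i = {⟨i, f i⟩} := by
  ext ⟨j, y⟩
  simp only [transversalSet, vertexClass, Set.mem_inter_iff, Set.mem_ofPred_eq,
    Set.mem_singleton_iff]
  constructor
  · rintro ⟨rfl, rfl⟩
    rfl
  · intro h
    cases h
    exact ⟨rfl, rfl⟩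

theorem transversalSet_mem_edgeSet (f : ∀ i, Fin (n i)) :
    transversalSet f ∈ (completeMultipartiteHypergraph n).edgeSet := by
  refine ⟨?_, fun i => by rw [transversalSet_inter_vertexClass, Set.encard_singleton]⟩
  have : transversalSet f = Set.range fun i => (⟨i, f i⟩ : PartVertex n) := by
    ext ⟨j, y⟩
    simp only [transversalSet, Set.mem_ofPred_eq, Set.mem_range]
    constructor
    · rintro rfl
      exact ⟨j, rfl⟩
    · rintro ⟨i, h⟩
      cases h
      rfl
  rw [this, ← Set.image_univ, Function.Injective.encard_image, Set.encard_univ]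
  · simp
  · intro i j h
    exact congrArg Sigma.fst h

theorem transversalSet_injective : Injective (transversalSet (n := n)) := by
  intro f g h
  funext i
  have := transversalSet_inter_vertexClass f i
  rw [h, transversalSet_inter_vertexClass] at this
  simpa using this.symm

/-- The edges of the complete `r`-partite hypergraph are the transversals of its classes. -/
noncomputable def edgeEquiv (n : Fin r → ℕ) :
    (∀ i, Fin (n i)) ≃ (completeMultipartiteHypergraph n).edgeSet :=
  Equiv.ofBijective (fun f => ⟨transversalSet f, transversalSet_mem_edgeSet f⟩) <| by
    refine ⟨fun f g h => transversalSet_injective (congrArg Subtype.val h), ?_⟩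
    rintro ⟨e, he, he'⟩
    choose v hv using fun i => Set.encard_eq_one.1 (he' i)
    have hvi : ∀ i, v i ∈ e ∧ (v i).1 = i := fun i => by
      have : v i ∈ e ∩ vertexClass n i := by rw [hv i]; rfl
      exact this
    have hex : ∀ i, ∃ y : Fin (n i), v i = ⟨i, y⟩ := by
      intro i
      have h := (hvi i).2
      generalize v i = w at h
      subst h
      exact ⟨w.2, rfl⟩
    choose f hf using hex
    refine ⟨f, Subtype.ext ?_⟩
    ext ⟨i, y⟩
    have h1 : (⟨i, y⟩ : PartVertex n) ∈ e ↔ (⟨i, y⟩ : PartVertex n) ∈ e ∩ vertexClass n i :=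
      ⟨fun h => ⟨h, rfl⟩, fun h => h.1⟩
    rw [h1, hv i, hf i]
    change f i = y ↔ _
    simp [eq_comm]

theorem coe_edgeEquiv (f : ∀ i, Fin (n i)) :
    (edgeEquiv n f : Set (PartVertex n)) = transversalSet f := rfl

theorem disjoint_edgeEquiv (f g : ∀ i, Fin (n i)) :
    Disjoint (edgeEquiv n f : Set (PartVertex n)) (edgeEquiv n g) ↔ ∀ i, f i ≠ g i := by
  rw [coe_edgeEquiv, coe_edgeEquiv, Set.disjoint_left]
  constructor
  · intro h i hi
    exact h (a := ⟨i, f i⟩) rfl hi.symm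
  · rintro h ⟨i, y⟩ hf hg
    exact h i (Eq.trans hf (Eq.symm hg))

theorem usesExactly_iff {c : EdgeColoring (completeMultipartiteHypergraph n)} {m : ℕ} :
    UsesExactly c m ↔ #(univ.image (c ∘ edgeEquiv n)) = m := by
  have : Set.range c = (univ.image (c ∘ edgeEquiv n) : Finset ℕ) := by
    rw [coe_image, coe_univ, Set.image_univ, (edgeEquiv n).surjective.range_comp]
  rw [UsesExactly, this, Set.encard_coe_eq_coe_finsetCard, Nat.cast_inj]

theorem not_hasRainbowMatching_iff (hr : 0 < r)
    {c : EdgeColoring (completeMultipartiteHypergraph n)} {k : ℕ} :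
    ¬ HasRainbowMatching c k ↔ RainbowFree (c ∘ edgeEquiv n) k := by
  classical
  constructor
  · intro h e he hinj
    have heinj : Injective e := fun s s' hs => he ⟨0, hr⟩ (congrFun hs _)
    refine h ⟨univ.image (edgeEquiv n ∘ e), ?_, ?_, ?_⟩
    · rw [card_image_of_injective _ ((edgeEquiv n).injective.comp heinj), card_univ,
        Fintype.card_fin]
    · intro x hx y hy hxy
      obtain ⟨s, -, rfl⟩ := mem_image.1 hx
      obtain ⟨s', -, rfl⟩ := mem_image.1 hy
      rw [comp_apply, comp_apply, disjoint_edgeEquiv]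
      intro i hi
      exact hxy (congrArg _ (he i hi))
    · intro x hx y hy hxy
      obtain ⟨s, -, rfl⟩ := mem_image.1 (mem_coe.1 hx)
      obtain ⟨s', -, rfl⟩ := mem_image.1 (mem_coe.1 hy)
      exact congrArg _ (hinj hxy)
  · rintro h ⟨M, hM, hmatch, hinj⟩
    have hval : ∀ x, edgeEquiv n ((edgeEquiv n).symm x) = x := (edgeEquiv n).apply_symm_apply
    refine absurd (h.card_lt (σ := fun x : M => (edgeEquiv n).symm x) ?_ univ ?_) ?_
    · intro i x y hxy
      by_contra hne
      have := hmatch x x.2 y y.2 fun h => hne (Subtype.ext h)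
      rw [← hval x, ← hval y, disjoint_edgeEquiv] at this
      exact this i hxy
    · intro x _ y _ hxy
      simp only [comp_apply, hval] at hxy
      exact Subtype.ext (hinj x.2 y.2 hxy)
    · rw [card_univ, Fintype.card_coe, hM]
      exact lt_irrefl k

theorem isPhiColoring_iff {r : ℕ} {n : Fin (r + 2) → ℕ} (hmin : ∀ i, n 0 ≤ n i) {k : ℕ}
    (hk : 3 ≤ k) (h0 : 2 * k - 1 ≤ n 0) {c : EdgeColoring (completeMultipartiteHypergraph n)} :
    IsPhiColoring n k c ↔ IsStarColoring (c ∘ edgeEquiv n) k := by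
  classical
  constructor
  · rintro ⟨j, hj, S, hSj, hS, hinj, a, ha⟩
    set T : Finset (Fin (n j)) := {y | (⟨j, y⟩ : PartVertex n) ∈ S} with hT
    have hST : S = T.map ⟨Sigma.mk j, sigma_mk_injective⟩ := by
      ext ⟨i, y⟩
      simp only [hT, mem_map, mem_filter, mem_univ, true_and, Embedding.coeFn_mk]
      constructor
      · intro h
        have : i = j := hSj (mem_coe.2 h)
        subst this
        exact ⟨y, h, rfl⟩
      · rintro ⟨z, hz, h⟩
        exact h ▸ hz
    have hmeet : ∀ f, ((edgeEquiv n f : Set (PartVertex n)) ∩ S).Nonempty ↔ f j ∈ T := by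
      intro f
      rw [hT, mem_filter]
      constructor
      · rintro ⟨⟨i, y⟩, hf, hy⟩
        have : i = j := hSj hy
        subst this
        have hf' : f i = y := hf
        exact ⟨mem_univ _, hf' ▸ mem_coe.1 hy⟩
      · rintro ⟨-, h⟩
        exact ⟨⟨j, f j⟩, rfl, mem_coe.2 h⟩
    refine ⟨j, a, T, le_antisymm (hj 0) (hmin j), ?_, ?_, ?_⟩
    · rw [← hS, hST, card_map]
    · intro f hf
      exact (ha _).2 fun h => hf ((hmeet f).1 h)
    · intro f g hf hfg
      have hf' := (hmeet f).2 hf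
      have hg' : ((edgeEquiv n g : Set (PartVertex n)) ∩ S).Nonempty := by
        by_contra h
        exact (ha (edgeEquiv n f)).1 (Eq.trans hfg ((ha _).2 h)) hf'
      exact (edgeEquiv n).injective (hinj hf' hg' hfg)
  · rintro ⟨j, a, T, hj, hT, hoff, hon⟩
    have hmeet : ∀ f, ((edgeEquiv n f : Set (PartVertex n)) ∩
        (T.map ⟨Sigma.mk j, sigma_mk_injective⟩ : Finset (PartVertex n))).Nonempty ↔ f j ∈ T := by
      intro f
      constructor
      · rintro ⟨v, hf, hv⟩
        obtain ⟨y, hy, rfl⟩ := mem_map.1 (mem_coe.1 hv)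
        have hf' : f j = y := hf
        rwa [hf']
      · intro h
        exact ⟨⟨j, f j⟩, rfl, mem_coe.2 (mem_map.2 ⟨f j, h, rfl⟩)⟩
    refine ⟨j, fun i => hj ▸ hmin i, T.map ⟨Sigma.mk j, sigma_mk_injective⟩, ?_, ?_, ?_, a, ?_⟩
    · intro v hv
      obtain ⟨y, -, rfl⟩ := mem_map.1 (mem_coe.1 hv)
      rfl
    · rw [card_map, hT]
    · intro x hx y hy hxy
      obtain ⟨f, rfl⟩ := (edgeEquiv n).surjective x
      obtain ⟨g, rfl⟩ := (edgeEquiv n).surjective y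
      exact congrArg _ (hon f g ((hmeet f).1 hx) hxy)
    · intro x
      obtain ⟨f, rfl⟩ := (edgeEquiv n).surjective x
      rw [hmeet]
      refine ⟨fun hfa hf => ?_, hoff f⟩
      obtain ⟨g, hg⟩ := exists_coord_notMem_of_card_lt hmin (j := j) (S := T) (by omega)
      exact hg (hon f g hf (hfa.trans (hoff g hg).symm) ▸ hf)

end Transfer

theorem theorem3 (r k : ℕ) (hr : 2 ≤ r) (hk : 3 ≤ k) (n : Fin r → ℕ) (hn : Monotone n)
    (hn1 : 2 * k - 1 ≤ n ⟨0, by omega⟩) :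
    IsAntiRamseyNumber (completeMultipartiteHypergraph n) k
      ((k - 2) * (∏ i ∈ Finset.univ.erase (⟨0, by omega⟩ : Fin r), n i) + 1) ∧
    ∀ c : EdgeColoring (completeMultipartiteHypergraph n),
      (UsesExactly c ((k - 2) * (∏ i ∈ Finset.univ.erase (⟨0, by omega⟩ : Fin r), n i) + 1) ∧
        ¬ HasRainbowMatching c k) ↔ IsPhiColoring n k c := by
  obtain ⟨r, rfl⟩ : ∃ r', r = r' + 2 := ⟨r - 2, by omega⟩
  have hmin : ∀ i, n 0 ≤ n i := fun i => hn (Fin.zero_le i)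
  have h0 : 2 * k - 1 ≤ n 0 := hn1
  have hprod : ∏ i ∈ Finset.univ.erase (⟨0, by omega⟩ : Fin (r + 2)), n i =
      ∏ i : Fin (r + 1), n i.succ := by
    have h := Finset.mul_prod_erase univ n (mem_univ (0 : Fin (r + 2)))
    rw [Fin.prod_univ_succ n] at h
    exact Nat.eq_of_mul_eq_mul_left (by omega) h
  rw [hprod]
  simp only [usesExactly_iff, not_hasRainbowMatching_iff (n := n) (k := k) (Nat.succ_pos _),
    isPhiColoring_iff hmin hk h0, IsAntiRamseyNumber]
  refine ⟨⟨?_, ?_⟩, fun c => ⟨fun h => ?_, fun h => ?_⟩⟩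
  · obtain ⟨c, hc⟩ := exists_isStarColoring h0 hk
    have hcomp : (c ∘ (edgeEquiv n).symm) ∘ edgeEquiv n = c := by
      rw [comp_assoc, Equiv.symm_comp_self, comp_id]
    refine ⟨c ∘ (edgeEquiv n).symm, ?_⟩
    rw [hcomp]
    exact ⟨hc.card_image hmin hk h0, hc.rainbowFree hk⟩
  · rintro m ⟨c, rfl, hc⟩
    by_contra! h
    exact absurd (isStarColoring_of_rainbowFree hmin hk h0 hc h.le).2 h.not_ge
  · exact (isStarColoring_of_rainbowFree hmin hk h0 h.2 h.1.ge).1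
  · exact ⟨h.card_image hmin hk h0, h.rainbowFree hk⟩
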